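/- For $n\ge 0$ let $G_n=\sum_{k=0}^{n}\left(\frac{1\cdot 3\cdots(2k-1)}{2\cdot 4\cdots(2k)}\right)^2$ be the Landau constants (the term $k=0$ being $1$), let $N=n+1$, and let $\gamma$ be Euler's constant. Then $\pi G_n$ has an asymptotic expansion $$\pi G_n\sim \ln(16N)+\gamma+\sum_{k=1}^{\infty}\frac{\alpha_k}{N^k},\qquad n\to\infty,$$ with real constants $\alpha_k$, meaning that for every $l\ge 0$ $$\pi G_n-\ln(16N)-\gamma-\sum_{k=1}^{l}\frac{\alpha_k}{N^k}=o(N^{-l}),\qquad n\to\infty,$$ and its coefficients satisfy $$(-1)^{\frac{l(l+1)}{2}}\alpha_{l+1}<0\qquad\text{for all } l=0,1,2,\dots.$$ -/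

import Mathlib

open Filter Asymptotics

/-- The `n`-th Landau constant
`G_n = 1 + (1/2)^2 + (1·3/(2·4))^2 + ⋯ + (1·3⋯(2n-1)/(2·4⋯(2n)))^2`. -/
noncomputable def landauConstant (n : ℕ) : ℝ :=
  ∑ k ∈ Finset.range (n + 1),
    (∏ j ∈ Finset.range k, (2 * (j : ℝ) + 1) / (2 * (j : ℝ) + 2)) ^ 2

/-- The truncation `A_l(N) = ln(16 N) + γ + ∑_{k=1}^l α_k / N^k`. -/
noncomputable def granathTruncation (α : ℕ → ℝ) (l : ℕ) (N : ℝ) : ℝ :=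
  Real.log (16 * N) + Real.eulerMascheroniConstant
    + ∑ k ∈ Finset.Icc 1 l, α k / N ^ k

/-- `α_1, α_2, …` are the coefficients of the (Poincaré) asymptotic expansion
`π G_n ∼ ln(16 N) + γ + ∑_{k ≥ 1} α_k / N^k` as `n → ∞`, where `N = n + 1`: for every `l`,
the error of the truncation at order `l` is `o(N^{-l})`. The value `α 0` plays no role. -/
def IsGranathExpansion (α : ℕ → ℝ) : Prop :=
  ∀ l : ℕ,
    (fun n : ℕ => Real.pi * landauConstant n - granathTruncation α l ((n : ℝ) + 1))
      =o[atTop] (fun n : ℕ => 1 / ((n : ℝ) + 1) ^ l)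

/-! Put `a N = π * w N ^ 2`, where `w N` is the Wallis ratio, so that
`(2 * N + 2) ^ 2 * a (N + 1) = (2 * N + 1) ^ 2 * a N`. Substituting a formal Laplace transform
`4 * ∫ exp (-4 * N * s) * F s ds` turns this recurrence into a linear differential equation, solved
by `F s = exp (-s) * P (s)` with `P (s) = P_{-1/2}(cosh (2 * s))`. Summation over `N` divides by
`1 - exp (-4 * s)`; the coefficients of the expansion are therefore, up to positive factors, the
negatives of the Taylor coefficients of `P (s) * (s / sinh s + s / cosh s)`. After `s ↦ I * s` the
series of `P (s)`, `s / sinh s` and `1 / cosh s` have nonnegative coefficients: this follows from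
recurrences given by the equation for `P` and by the Riccati equations for `tanh` and `coth`. The
sign pattern has period four because `s / sinh s` contributes in even degrees and `s / cosh s` in
odd ones.

The constant term comes from summing
`π / 2 * w k ^ 2 - 1 / (2 * k + 1) = w k * ∫ (cos x ^ (2 * k) - cos x ^ (2 * k + 1))` over `k`,
which gives `∫ sin x / (1 + cos x) = log 2`, the integrals being over `[0, π / 2]`. -/

section WallisRatio

open Real Finset

/-- The Wallis ratio `1·3⋯(2k-1) / (2·4⋯(2k))`, whose squares are the summands of the Landau
constants. -/
noncomputable def wallisRatio (k : ℕ) : ℝ :=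
  ∏ j ∈ range k, (2 * (j : ℝ) + 1) / (2 * (j : ℝ) + 2)

theorem wallisRatio_zero : wallisRatio 0 = 1 :=
  prod_range_zero _

theorem wallisRatio_succ (k : ℕ) :
    wallisRatio (k + 1) = wallisRatio k * ((2 * (k : ℝ) + 1) / (2 * k + 2)) :=
  prod_range_succ _ k

theorem wallisRatio_pos (k : ℕ) : 0 < wallisRatio k :=
  prod_pos fun _ _ => by positivity

theorem wallisRatio_sq_mul (k : ℕ) : wallisRatio k ^ 2 * (2 * k + 1) = (Wallis.W k)⁻¹ := by
  induction k with
  | zero => simp [wallisRatio_zero, Wallis.W]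
  | succ k ih =>
    have := (Wallis.W_pos k).ne'
    rw [Wallis.W_succ, mul_inv, ← ih, wallisRatio_succ]
    push_cast
    field_simp
    ring

theorem tendsto_mul_pi_mul_wallisRatio_sq :
    Tendsto (fun N : ℕ => (N : ℝ) * (π * wallisRatio N ^ 2)) atTop (nhds 1) := by
  have h_half : Tendsto (fun N : ℕ => π * ((N : ℝ) / (2 * N + 1))) atTop (nhds (π / 2)) := by
    have h := (tendsto_natCast_div_add_atTop (1 / 2 : ℝ)).const_mul (π / 2)
    rw [mul_one] at h
    refine h.congr fun N => ?_
    field_simp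
  have h := h_half.mul (Wallis.tendsto_W_nhds_pi_div_two.inv₀ (by positivity))
  rw [mul_inv_cancel₀ (by positivity)] at h
  refine h.congr fun N => ?_
  rw [← wallisRatio_sq_mul]
  field_simp

theorem integral_cos_pow_even (k : ℕ) :
    ∫ x in (0 : ℝ)..π / 2, cos x ^ (2 * k) = π / 2 * wallisRatio k := by
  rw [EulerSine.integral_cos_pow_eq, integral_sin_pow_even, wallisRatio]
  ring

theorem wallisRatio_mul_integral_cos_pow_odd (k : ℕ) :
    wallisRatio k * ∫ x in (0 : ℝ)..π / 2, cos x ^ (2 * k + 1) = 1 / (2 * k + 1) := by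
  rw [EulerSine.integral_cos_pow_eq, integral_sin_pow_odd]
  induction k with
  | zero => simp [wallisRatio_zero]
  | succ k ih =>
    rw [wallisRatio_succ, prod_range_succ]
    rw [eq_div_iff (by positivity)] at ih ⊢
    push_cast
    field_simp at ih ⊢
    linear_combination (2 * (k : ℝ) + 3) * ih

theorem choose_half_eq_wallisRatio (n : ℕ) :
    Ring.choose ((1 / 2 : ℝ) + n - 1) n = wallisRatio n := by
  rw [Ring.choose_eq_smul, Polynomial.descPochhammer_smeval_eq_ascPochhammer,
    Polynomial.ascPochhammer_smeval_eq_eval, show (1 / 2 : ℝ) + n - 1 - n + 1 = 1 / 2 by ring]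
  induction n with
  | zero => simp [wallisRatio_zero]
  | succ n ih =>
    rw [wallisRatio_succ, ← ih, ascPochhammer_succ_eval, Nat.factorial_succ]
    simp only [smul_eq_mul]
    push_cast
    field_simp
    ring

theorem hasSum_wallisRatio_mul_pow {x : ℝ} (hx : |x| < 1) :
    HasSum (fun k => wallisRatio k * x ^ k) (1 / √(1 - x)) := by
  have h := (one_div_one_sub_rpow_hasFPowerSeriesOnBall_zero (1 / 2)).hasSum (y := x)
    (by simpa [enorm_eq_nnnorm, ← NNReal.coe_lt_coe] using hx)
  simpa only [FormalMultilinearSeries.ofScalars_apply_eq, choose_half_eq_wallisRatio, zero_add,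
    smul_eq_mul, ← Real.sqrt_eq_rpow] using h

theorem hasSum_wallisRatio_mul_cos_pow {x : ℝ} (hx : 0 < x) (hx' : x ≤ π / 2) :
    HasSum (fun k => wallisRatio k * (cos x ^ (2 * k) - cos x ^ (2 * k + 1)))
      (sin x / (1 + cos x)) := by
  have h_sin : 0 < sin x := sin_pos_of_pos_of_lt_pi hx (by linarith [pi_pos])
  have h_cos : 0 ≤ cos x := cos_nonneg_of_mem_Icc ⟨by linarith [pi_pos], hx'⟩
  have h_lt : |cos x ^ 2| < 1 := by
    rw [abs_of_nonneg (sq_nonneg _), cos_sq']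
    linarith [pow_pos h_sin 2]
  have h := (hasSum_wallisRatio_mul_pow h_lt).mul_right (1 - cos x)
  have h_value : 1 / √(1 - cos x ^ 2) * (1 - cos x) = sin x / (1 + cos x) := by
    rw [← sin_sq, sqrt_sq h_sin.le]
    field_simp
    linear_combination -sin_sq_add_cos_sq x
  rw [h_value] at h
  refine h.congr_fun fun k => ?_
  ring

theorem one_add_cos_ne_zero {x : ℝ} (hx : x ∈ Set.uIcc 0 (π / 2)) : 1 + cos x ≠ 0 := by
  rw [Set.uIcc_of_le (by positivity)] at hx
  linarith [cos_nonneg_of_mem_Icc ⟨by linarith [pi_pos, hx.1], hx.2⟩]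

theorem intervalIntegrable_sin_div_one_add_cos :
    IntervalIntegrable (fun x => sin x / (1 + cos x)) MeasureTheory.volume 0 (π / 2) :=
  (continuous_sin.continuousOn.div (by fun_prop) fun _ => one_add_cos_ne_zero).intervalIntegrable

theorem integral_sin_div_one_add_cos :
    ∫ x in (0 : ℝ)..π / 2, sin x / (1 + cos x) = log 2 := by
  have h_deriv : ∀ x ∈ Set.uIcc 0 (π / 2),
      HasDerivAt (fun x => -log (1 + cos x)) (sin x / (1 + cos x)) x := fun x hx => by
    simpa [neg_div] using (((hasDerivAt_cos x).const_add 1).log (one_add_cos_ne_zero hx)).fun_neg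
  rw [intervalIntegral.integral_eq_sub_of_hasDerivAt h_deriv
    intervalIntegrable_sin_div_one_add_cos]
  norm_num

theorem hasSum_wallisRatio_sq_sub :
    HasSum (fun k : ℕ => π / 2 * wallisRatio k ^ 2 - 1 / (2 * k + 1)) (log 2) := by
  have h_Ioc : Set.uIoc 0 (π / 2) = Set.Ioc 0 (π / 2) := Set.uIoc_of_le (by positivity)
  have h_int : ∀ n : ℕ, IntervalIntegrable (fun x => cos x ^ n) MeasureTheory.volume 0 (π / 2) :=
    fun n => Continuous.intervalIntegrable (by fun_prop) _ _
  have h_term : ∀ k : ℕ, π / 2 * wallisRatio k ^ 2 - 1 / (2 * k + 1) =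
      ∫ x in (0 : ℝ)..π / 2, wallisRatio k * (cos x ^ (2 * k) - cos x ^ (2 * k + 1)) := fun k => by
    rw [intervalIntegral.integral_const_mul, intervalIntegral.integral_sub (h_int _) (h_int _),
      mul_sub, wallisRatio_mul_integral_cos_pow_odd, integral_cos_pow_even]
    ring
  simp only [h_term]
  rw [← integral_sin_div_one_add_cos]
  have h_sum : ∀ x ∈ Set.uIoc 0 (π / 2), HasSum
      (fun k => wallisRatio k * (cos x ^ (2 * k) - cos x ^ (2 * k + 1))) (sin x / (1 + cos x)) :=
    fun x hx => by
      rw [h_Ioc] at hx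
      exact hasSum_wallisRatio_mul_cos_pow hx.1 hx.2
  refine intervalIntegral.hasSum_integral_of_dominated_convergence
    (fun k x => wallisRatio k * (cos x ^ (2 * k) - cos x ^ (2 * k + 1)))
    (fun k => Continuous.aestronglyMeasurable (by fun_prop))
    (fun k => Eventually.of_forall fun x hx => ?_)
    (Eventually.of_forall fun x hx => (h_sum x hx).summable) ?_
    (Eventually.of_forall h_sum)
  · rw [h_Ioc] at hx
    have h_cos : 0 ≤ cos x := cos_nonneg_of_mem_Icc ⟨by linarith [hx.1, pi_pos], hx.2⟩
    exact (norm_of_nonneg (mul_nonneg (wallisRatio_pos k).le (sub_nonneg.2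
      (pow_le_pow_of_le_one h_cos (cos_le_one x) (Nat.le_succ _))))).le
  · exact intervalIntegrable_sin_div_one_add_cos.congr fun x hx => (h_sum x hx).tsum_eq.symm

theorem sum_two_div_odd (N : ℕ) :
    ∑ k ∈ range N, 2 / (2 * (k : ℝ) + 1) = 2 * (harmonic (2 * N) : ℝ) - harmonic N := by
  induction N with
  | zero => simp
  | succ N ih =>
    rw [sum_range_succ, ih, show 2 * (N + 1) = 2 * N + 1 + 1 by ring, harmonic_succ,
      harmonic_succ, harmonic_succ]
    push_cast
    field_simp
    ring

theorem tendsto_sum_pi_mul_wallisRatio_sq_sub_log :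
    Tendsto (fun N : ℕ => ∑ k ∈ range N, π * wallisRatio k ^ 2 - log N) atTop
      (nhds (log 16 + eulerMascheroniConstant)) := by
  have h_even : Tendsto (fun N : ℕ => (harmonic (2 * N) : ℝ) - log ((2 * N : ℕ) : ℝ)) atTop
      (nhds eulerMascheroniConstant) :=
    tendsto_harmonic_sub_log.comp (tendsto_id.const_mul_atTop' two_pos)
  have h := (((hasSum_wallisRatio_sq_sub.tendsto_sum_nat.const_mul 2).add
    (h_even.const_mul 2)).sub tendsto_harmonic_sub_log).add_const (2 * log 2)
  have h_const : 2 * log 2 + 2 * eulerMascheroniConstant - eulerMascheroniConstant + 2 * log 2 =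
      log 16 + eulerMascheroniConstant := by
    rw [show (16 : ℝ) = 2 ^ 4 by norm_num, log_pow]
    push_cast
    ring
  rw [h_const] at h
  refine h.congr' ?_
  filter_upwards [eventually_gt_atTop 0] with N hN
  have h_odd : 2 * ∑ k ∈ range N, (π / 2 * wallisRatio k ^ 2 - 1 / (2 * (k : ℝ) + 1)) =
      ∑ k ∈ range N, π * wallisRatio k ^ 2 - ∑ k ∈ range N, 2 / (2 * (k : ℝ) + 1) := by
    rw [mul_sum, ← sum_sub_distrib]
    exact sum_congr rfl fun k _ => by ring
  have hN' : (N : ℝ) ≠ 0 := by positivity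
  rw [h_odd, sum_two_div_odd]
  push_cast
  rw [log_mul two_ne_zero hN']
  ring

end WallisRatio

section HyperbolicSeries

open PowerSeries Nat

theorem coeff_X_mul_derivative {R : Type*} [CommSemiring R] (P : R⟦X⟧) (n : ℕ) :
    coeff n (X * d⁄dX R P) = n * coeff n P := by
  rcases n with _ | n
  · simp
  · rw [coeff_succ_X_mul, coeff_derivative]
    push_cast
    ring

/-- The Taylor series of `cosh s`. -/
noncomputable def coshSeries : ℝ⟦X⟧ :=
  mk fun n => if Even n then 1 / (n ! : ℝ) else 0

/-- The Taylor series of `sinh s / s`. -/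
noncomputable def sinhcSeries : ℝ⟦X⟧ :=
  mk fun n => if Even n then 1 / ((n + 1)! : ℝ) else 0

/-- The Taylor series of `(cosh s - sinh s / s) / s ^ 2`. -/
noncomputable def coshSubSinhcSeries : ℝ⟦X⟧ :=
  mk fun n => if Even n then (n + 2) / ((n + 3)! : ℝ) else 0

/-- The Taylor series of `tanh s / s`. -/
noncomputable def tanhcSeries : ℝ⟦X⟧ :=
  sinhcSeries * coshSeries⁻¹

/-- The Taylor series of `(s * coth s - 1) / s ^ 2`. -/
noncomputable def cothcSeries : ℝ⟦X⟧ :=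
  coshSubSinhcSeries * sinhcSeries⁻¹

theorem constantCoeff_coshSeries : constantCoeff coshSeries = 1 := by
  simp [← coeff_zero_eq_constantCoeff_apply, coshSeries]

theorem constantCoeff_sinhcSeries : constantCoeff sinhcSeries = 1 := by
  simp [← coeff_zero_eq_constantCoeff_apply, sinhcSeries]

theorem constantCoeff_coshSubSinhcSeries : constantCoeff coshSubSinhcSeries = 1 / 3 := by
  norm_num [← coeff_zero_eq_constantCoeff_apply, coshSubSinhcSeries, factorial]

theorem coshSeries_mul_inv : coshSeries * coshSeries⁻¹ = 1 :=
  PowerSeries.mul_inv_cancel _ (by simp [constantCoeff_coshSeries])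

theorem sinhcSeries_mul_inv : sinhcSeries * sinhcSeries⁻¹ = 1 :=
  PowerSeries.mul_inv_cancel _ (by simp [constantCoeff_sinhcSeries])

theorem coshSeries_eq_add : coshSeries = sinhcSeries + X ^ 2 * coshSubSinhcSeries := by
  ext n
  rcases n with _ | _ | n
  · simp [coshSeries, sinhcSeries]
  · simp [coshSeries, sinhcSeries, coeff_X_pow_mul']
  · rw [map_add, coeff_X_pow_mul _ 2 n]
    simp only [coshSeries, sinhcSeries, coshSubSinhcSeries, coeff_mk, Nat.even_add_one, not_not]
    split_ifs
    · rw [factorial_succ (n + 1 + 1)]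
      push_cast
      field_simp
      ring
    · simp

theorem derivative_coshSeries : d⁄dX ℝ coshSeries = X * sinhcSeries := by
  ext n
  rw [coeff_derivative]
  rcases n with _ | n
  · simp [coshSeries]
  · rw [coeff_succ_X_mul]
    simp only [coshSeries, sinhcSeries, coeff_mk, Nat.even_add_one, not_not, factorial_succ (n + 1)]
    split_ifs
    · push_cast
      field_simp
    · simp

theorem derivative_sinhcSeries : d⁄dX ℝ sinhcSeries = X * coshSubSinhcSeries := by
  ext n
  rw [coeff_derivative]
  rcases n with _ | n
  · simp [sinhcSeries]
  · rw [coeff_succ_X_mul]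
    simp only [sinhcSeries, coshSubSinhcSeries, coeff_mk, Nat.even_add_one, not_not]
    split_ifs
    · push_cast
      ring
    · simp

theorem X_mul_derivative_coshSubSinhcSeries :
    X * d⁄dX ℝ coshSubSinhcSeries = sinhcSeries - 3 * coshSubSinhcSeries := by
  ext n
  rw [coeff_X_mul_derivative, map_sub, ← map_ofNat (C (R := ℝ)), coeff_C_mul]
  simp only [sinhcSeries, coshSubSinhcSeries, coeff_mk]
  split_ifs
  · rw [factorial_succ (n + 2), factorial_succ (n + 1)]
    push_cast
    field_simp
    ring
  · simp

theorem derivative_X_mul_sinhcSeries : d⁄dX ℝ (X * sinhcSeries) = coshSeries := by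
  rw [Derivation.leibniz, derivative_sinhcSeries, derivative_X, coshSeries_eq_add, smul_eq_mul,
    smul_eq_mul]
  ring

theorem coshSeries_sq_sub : coshSeries ^ 2 - (X * sinhcSeries) ^ 2 = 1 := by
  refine derivative.ext ?_ (by simp [constantCoeff_coshSeries])
  rw [map_sub, derivative_pow, derivative_pow, derivative_X_mul_sinhcSeries,
    derivative_coshSeries, Derivation.map_one_eq_zero]
  push_cast
  ring

theorem rescale_neg_one_exp : rescale (-1) (exp ℝ) = coshSeries - X * sinhcSeries := by
  ext n
  rw [coeff_rescale, coeff_exp, map_sub]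
  rcases n with _ | n
  · simp [coshSeries]
  · rw [coeff_succ_X_mul]
    rcases n.even_or_odd with hn | hn
    · simp [coshSeries, sinhcSeries, hn, Nat.even_add_one, hn.neg_one_pow, pow_succ]
    · simp [coshSeries, sinhcSeries, hn, hn.neg_one_pow, pow_succ, Nat.not_even_iff_odd.2 hn]

theorem rescale_neg_four_exp : rescale (-4) (exp ℝ) = (coshSeries - X * sinhcSeries) ^ 4 := by
  rw [← rescale_neg_one_exp, ← map_pow, exp_pow_eq_rescale_exp, rescale_rescale]
  norm_num

theorem derivative_coshSeries_inv :
    d⁄dX ℝ coshSeries⁻¹ = -(X * (tanhcSeries * coshSeries⁻¹)) := by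
  rw [derivative_inv', derivative_coshSeries, tanhcSeries]
  ring

theorem derivative_sinhcSeries_inv :
    d⁄dX ℝ sinhcSeries⁻¹ = -(X * (cothcSeries * sinhcSeries⁻¹)) := by
  rw [derivative_inv', derivative_sinhcSeries, cothcSeries]
  ring

theorem X_mul_derivative_tanhcSeries :
    X * d⁄dX ℝ tanhcSeries = 1 - tanhcSeries - X ^ 2 * tanhcSeries ^ 2 := by
  have h : d⁄dX ℝ tanhcSeries =
      sinhcSeries * d⁄dX ℝ coshSeries⁻¹ + coshSeries⁻¹ * d⁄dX ℝ sinhcSeries :=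
    Derivation.leibniz _ _ _
  rw [h, derivative_coshSeries_inv, derivative_sinhcSeries, tanhcSeries]
  linear_combination coshSeries_mul_inv - coshSeries⁻¹ * coshSeries_eq_add

theorem X_mul_derivative_cothcSeries :
    X * d⁄dX ℝ cothcSeries = 1 - 3 * cothcSeries - X ^ 2 * cothcSeries ^ 2 := by
  have h : d⁄dX ℝ cothcSeries = coshSubSinhcSeries * d⁄dX ℝ sinhcSeries⁻¹ +
      sinhcSeries⁻¹ * d⁄dX ℝ coshSubSinhcSeries :=
    Derivation.leibniz _ _ _
  rw [h, derivative_sinhcSeries_inv, cothcSeries]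
  linear_combination
    sinhcSeries⁻¹ * X_mul_derivative_coshSubSinhcSeries + sinhcSeries_mul_inv

end HyperbolicSeries

section Alternation

open PowerSeries Finset Complex
open scoped ComplexOrder

/-- The coefficients of `P (I * s)` of degree less than `n` are nonnegative reals. Equivalently, in
these degrees the odd coefficients of `P` vanish and the even ones have alternating signs, starting
with `+`. -/
def AlternatesBelow (n : ℕ∞) (P : ℝ⟦X⟧) : Prop :=
  ∀ i : ℕ, i < n → 0 ≤ I ^ i * (coeff i P : ℝ)

theorem I_pow_mul_coeff_mul (P Q : ℝ⟦X⟧) (i : ℕ) :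
    I ^ i * (coeff i (P * Q) : ℝ) =
      ∑ p ∈ antidiagonal i, I ^ p.1 * (coeff p.1 P : ℝ) * (I ^ p.2 * (coeff p.2 Q : ℝ)) := by
  rw [coeff_mul, ofReal_sum, mul_sum]
  refine sum_congr rfl fun p hp => ?_
  rw [← mem_antidiagonal.1 hp, pow_add, ofReal_mul, mul_mul_mul_comm]

namespace AlternatesBelow

variable {n : ℕ∞} {P Q G : ℝ⟦X⟧}

theorem add (hP : AlternatesBelow n P) (hQ : AlternatesBelow n Q) :
    AlternatesBelow n (P + Q) := fun i hi => by
  rw [map_add, ofReal_add, mul_add]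
  exact add_nonneg (hP i hi) (hQ i hi)

theorem mul (hP : AlternatesBelow n P) (hQ : AlternatesBelow n Q) :
    AlternatesBelow n (P * Q) := fun i hi => by
  rw [I_pow_mul_coeff_mul]
  refine sum_nonneg fun ⟨j, k⟩ hjk => ?_
  obtain rfl : j + k = i := mem_antidiagonal.1 hjk
  exact mul_nonneg (hP j (lt_of_le_of_lt (by simp) hi)) (hQ k (lt_of_le_of_lt (by simp) hi))

theorem X_mul_derivative (hP : AlternatesBelow n P) : AlternatesBelow n (X * d⁄dX ℝ P) :=
  fun i hi => by
    rw [coeff_X_mul_derivative, ofReal_mul, mul_left_comm]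
    exact mul_nonneg (by simp) (hP i hi)

theorem of_top (hP : AlternatesBelow ⊤ P) : AlternatesBelow n P :=
  fun i _ => hP i (ENat.natCast_lt_top i)

theorem of_recurrence {c : ℕ → ℝ} (hc : ∀ i ≠ 0, 0 < c i) (hP : 0 ≤ constantCoeff P)
    (hG : ∀ i : ℕ, AlternatesBelow i P → AlternatesBelow i G)
    (h : ∀ i ≠ 0, c i * coeff i P = -coeff i (X ^ 2 * G)) : AlternatesBelow ⊤ P := by
  suffices h_below : ∀ i : ℕ, AlternatesBelow i P from
    fun i _ => h_below (i + 1) i (by exact_mod_cast i.lt_succ_self)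
  intro i
  induction i with
  | zero => exact fun j hj => by simp at hj
  | succ i ih =>
    intro j hj
    obtain hj | rfl := (Nat.lt_succ_iff_lt_or_eq.1 (by exact_mod_cast hj : j < i + 1))
    · exact ih j (by exact_mod_cast hj)
    rcases j with _ | _ | j
    · simpa using hP
    · have h_one := h 1 one_ne_zero
      rw [coeff_X_pow_mul', if_neg (by norm_num), neg_zero,
        mul_eq_zero_iff_left (hc 1 one_ne_zero).ne'] at h_one
      simp [h_one]
    · have h_coeff : coeff (j + 2) P = -(c (j + 2))⁻¹ * coeff j G := by
        have hj := h (j + 2) (by omega)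
        rw [coeff_X_pow_mul] at hj
        rw [neg_mul, ← mul_neg, ← hj, inv_mul_cancel_left₀ (hc _ (by omega)).ne']
      have h_step := mul_nonneg (a := (((c (j + 2))⁻¹ : ℝ) : ℂ))
        (by exact_mod_cast (inv_pos.2 (hc (j + 2) (by omega))).le)
        (hG _ ih j (by exact_mod_cast (by omega : j < j + 1 + 1)))
      refine h_step.trans_eq ?_
      rw [h_coeff]
      push_cast
      linear_combination ((c (j + 2) : ℂ)⁻¹ * I ^ j * (coeff j G : ℝ)) * I_sq

theorem coeff_odd (hP : AlternatesBelow ⊤ P) (k : ℕ) : coeff (2 * k + 1) P = 0 := by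
  have h := hP (2 * k + 1) (ENat.natCast_lt_top _)
  rw [pow_succ, pow_mul, I_sq, Complex.nonneg_iff] at h
  rcases neg_one_pow_eq_or ℂ k with hk | hk <;> simpa [hk] using h.2.symm

theorem coeff_even_nonneg (hP : AlternatesBelow ⊤ P) (k : ℕ) :
    0 ≤ (-1) ^ k * coeff (2 * k) P := by
  have h := hP (2 * k) (ENat.natCast_lt_top _)
  rw [pow_mul, I_sq] at h
  exact_mod_cast h

theorem coeff_even_mul_pos (hP : AlternatesBelow ⊤ P) (hQ : AlternatesBelow ⊤ Q) {k : ℕ}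
    (hPk : 0 < (-1) ^ k * coeff (2 * k) P) (hQ0 : 0 < constantCoeff Q) :
    0 < (-1) ^ k * coeff (2 * k) (P * Q) := by
  have h_term : (0 : ℂ) < I ^ (2 * k) * (coeff (2 * k) P : ℝ) * (I ^ 0 * (coeff 0 Q : ℝ)) := by
    rw [pow_mul, I_sq, coeff_zero_eq_constantCoeff_apply, pow_zero, one_mul]
    exact_mod_cast mul_pos hPk hQ0
  have h : (0 : ℂ) < I ^ (2 * k) * (coeff (2 * k) (P * Q) : ℝ) := by
    have h_nonneg : ∀ p ∈ antidiagonal (2 * k),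
        (0 : ℂ) ≤ I ^ p.1 * (coeff p.1 P : ℝ) * (I ^ p.2 * (coeff p.2 Q : ℝ)) := fun p _ =>
      mul_nonneg (hP p.1 (ENat.natCast_lt_top _)) (hQ p.2 (ENat.natCast_lt_top _))
    have h_mem : (2 * k, 0) ∈ antidiagonal (2 * k) := mem_antidiagonal.2 (add_zero _)
    rw [I_pow_mul_coeff_mul]
    exact h_term.trans_le (single_le_sum h_nonneg h_mem)
  rw [pow_mul, I_sq] at h
  exact_mod_cast h

end AlternatesBelow

end Alternation

section LegendreSeries

open PowerSeries

theorem alternatesBelow_tanhcSeries : AlternatesBelow ⊤ tanhcSeries :=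
  .of_recurrence (c := fun i => i + 1) (fun _ _ => by positivity)
    (by simp [tanhcSeries, constantCoeff_sinhcSeries, constantCoeff_coshSeries])
    (fun _ h => h.mul h) fun i hi => by
      have h := congrArg (coeff i) X_mul_derivative_tanhcSeries
      rw [coeff_X_mul_derivative, map_sub, map_sub, coeff_one, if_neg hi] at h
      rw [← pow_two]
      linear_combination h

theorem alternatesBelow_cothcSeries : AlternatesBelow ⊤ cothcSeries :=
  .of_recurrence (c := fun i => i + 3) (fun _ _ => by positivity)
    (by simp [cothcSeries, constantCoeff_sinhcSeries, constantCoeff_coshSubSinhcSeries])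
    (fun _ h => h.mul h) fun i hi => by
      have h := congrArg (coeff i) X_mul_derivative_cothcSeries
      rw [coeff_X_mul_derivative, map_sub, map_sub, coeff_one, if_neg hi,
        ← map_ofNat (C (R := ℝ)), coeff_C_mul] at h
      rw [← pow_two]
      linear_combination h

theorem AlternatesBelow.of_derivative_eq {P Q : ℝ⟦X⟧} (hQ : AlternatesBelow ⊤ Q)
    (hP : 0 ≤ constantCoeff P) (h : d⁄dX ℝ P = -(X * (Q * P))) : AlternatesBelow ⊤ P :=
  .of_recurrence (c := fun i => i) (fun _ hi => by positivity) hP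
    (fun _ hi => hQ.of_top.mul hi) fun i _ => by
      rw [← coeff_X_mul_derivative, h, ← map_neg]
      ring_nf

theorem alternatesBelow_coshSeries_inv : AlternatesBelow ⊤ coshSeries⁻¹ :=
  .of_derivative_eq alternatesBelow_tanhcSeries (by simp [constantCoeff_coshSeries])
    derivative_coshSeries_inv

theorem alternatesBelow_sinhcSeries_inv : AlternatesBelow ⊤ sinhcSeries⁻¹ :=
  .of_derivative_eq alternatesBelow_cothcSeries (by simp [constantCoeff_sinhcSeries])
    derivative_sinhcSeries_inv

/-- The generating series of the squared Wallis ratios, that is `₂F₁(1/2, 1/2; 1; z)`. -/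
noncomputable def wallisSqSeries : ℝ⟦X⟧ :=
  mk fun k => wallisRatio k ^ 2

theorem wallisSqSeries_differential_equation :
    4 * X * (1 - X) * d⁄dX ℝ (d⁄dX ℝ wallisSqSeries) + 4 * (1 - 2 * X) * d⁄dX ℝ wallisSqSeries =
      wallisSqSeries := by
  have h_split : 4 * X * (1 - X) * d⁄dX ℝ (d⁄dX ℝ wallisSqSeries) +
      4 * (1 - 2 * X) * d⁄dX ℝ wallisSqSeries =
      C 4 * (X * d⁄dX ℝ (d⁄dX ℝ wallisSqSeries) + d⁄dX ℝ wallisSqSeries -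
        X * d⁄dX ℝ (X * d⁄dX ℝ wallisSqSeries) - X * d⁄dX ℝ wallisSqSeries) := by
    rw [Derivation.leibniz, derivative_X, map_ofNat, smul_eq_mul, smul_eq_mul]
    ring
  rw [h_split]
  ext n
  simp only [coeff_C_mul, map_sub, map_add, coeff_X_mul_derivative, coeff_derivative,
    wallisSqSeries, coeff_mk, wallisRatio_succ]
  field_simp
  ring

/-- The Taylor series in `s` of the Legendre function `P_{-1/2}(cosh (2 * s))`, which is
`₂F₁(1/2, 1/2; 1; -sinh s ^ 2)`. -/
noncomputable def legendreSeries : ℝ⟦X⟧ :=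
  wallisSqSeries.subst (-(X * sinhcSeries) ^ 2)

theorem hasSubst_neg_sinh_sq : HasSubst (-(X * sinhcSeries) ^ 2) :=
  .of_constantCoeff_zero' (by simp)

theorem constantCoeff_legendreSeries : constantCoeff legendreSeries = 1 := by
  rw [← coeff_zero_eq_constantCoeff_apply, legendreSeries, coeff_subst' hasSubst_neg_sinh_sq,
    finsum_eq_single _ 0 fun k hk => by simp [hk]]
  simp [wallisSqSeries, wallisRatio_zero]

theorem derivative_subst_neg_sinh_sq (f : ℝ⟦X⟧) :
    d⁄dX ℝ (f.subst (-(X * sinhcSeries) ^ 2)) = -((d⁄dX ℝ f).subst (-(X * sinhcSeries) ^ 2) *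
      (X * sinhcSeries * coshSeries + X * sinhcSeries * coshSeries)) := by
  rw [derivative_subst hasSubst_neg_sinh_sq, map_neg, derivative_pow, derivative_X_mul_sinhcSeries]
  push_cast
  ring

theorem derivative_sinh_mul_cosh :
    d⁄dX ℝ (X * sinhcSeries * coshSeries) = coshSeries ^ 2 + (X * sinhcSeries) ^ 2 := by
  rw [Derivation.leibniz, derivative_X_mul_sinhcSeries, derivative_coshSeries, smul_eq_mul,
    smul_eq_mul]
  ring

theorem legendreSeries_differential_equation :
    X * sinhcSeries * coshSeries * (d⁄dX ℝ (d⁄dX ℝ legendreSeries) + legendreSeries) +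
      (coshSeries ^ 2 + (X * sinhcSeries) ^ 2) * d⁄dX ℝ legendreSeries = 0 := by
  let z : ℝ⟦X⟧ := -(X * sinhcSeries) ^ 2
  let f₁ : ℝ⟦X⟧ := (d⁄dX ℝ wallisSqSeries).subst z
  let f₂ : ℝ⟦X⟧ := (d⁄dX ℝ (d⁄dX ℝ wallisSqSeries)).subst z
  have h_ode : 4 * z * (1 - z) * f₂ + 4 * (1 - 2 * z) * f₁ = legendreSeries := by
    have h := congrArg (substAlgHom hasSubst_neg_sinh_sq) wallisSqSeries_differential_equation
    simp only [map_add, map_mul, map_sub, map_one, map_ofNat, coe_substAlgHom,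
      subst_X hasSubst_neg_sinh_sq] at h
    exact h
  have h₁ : d⁄dX ℝ legendreSeries =
      -(f₁ * (X * sinhcSeries * coshSeries + X * sinhcSeries * coshSeries)) :=
    derivative_subst_neg_sinh_sq _
  have h₂ : d⁄dX ℝ (d⁄dX ℝ legendreSeries) = 4 * (X * sinhcSeries * coshSeries) ^ 2 * f₂ -
      2 * (coshSeries ^ 2 + (X * sinhcSeries) ^ 2) * f₁ := by
    rw [h₁, map_neg, Derivation.leibniz, derivative_subst_neg_sinh_sq, map_add,
      derivative_sinh_mul_cosh, smul_eq_mul, smul_eq_mul]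
    ring
  rw [h₂, h₁, ← h_ode]
  linear_combination (4 * (X * sinhcSeries) ^ 3 * coshSeries * f₂ -
    4 * X * sinhcSeries * coshSeries * f₁) * coshSeries_sq_sub

theorem X_mul_derivative_X_mul_derivative_legendreSeries :
    X * d⁄dX ℝ (X * d⁄dX ℝ legendreSeries) =
      -(X ^ 2 * ((cothcSeries + tanhcSeries) * (X * d⁄dX ℝ legendreSeries) + legendreSeries)) := by
  have h_coth : coshSeries * sinhcSeries⁻¹ = 1 + X ^ 2 * cothcSeries := by
    rw [cothcSeries, coshSeries_eq_add]
    linear_combination sinhcSeries_mul_inv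
  rw [Derivation.leibniz, derivative_X, smul_eq_mul, smul_eq_mul, tanhcSeries]
  linear_combination
    X * coshSeries⁻¹ * sinhcSeries⁻¹ * legendreSeries_differential_equation -
    X ^ 2 * (d⁄dX ℝ (d⁄dX ℝ legendreSeries) + legendreSeries) *
      (coshSeries * coshSeries⁻¹ * sinhcSeries_mul_inv + coshSeries_mul_inv) -
    X * d⁄dX ℝ legendreSeries * (coshSeries * sinhcSeries⁻¹ * coshSeries_mul_inv + h_coth +
      X ^ 2 * sinhcSeries * coshSeries⁻¹ * sinhcSeries_mul_inv)

theorem sq_mul_coeff_legendreSeries (n : ℕ) :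
    (n : ℝ) ^ 2 * coeff n legendreSeries = -coeff n (X ^ 2 *
      ((cothcSeries + tanhcSeries) * (X * d⁄dX ℝ legendreSeries) + legendreSeries)) := by
  rw [← map_neg, ← X_mul_derivative_X_mul_derivative_legendreSeries, coeff_X_mul_derivative,
    coeff_X_mul_derivative]
  ring

theorem alternatesBelow_coth_add_tanh_mul {n : ℕ∞} (h : AlternatesBelow n legendreSeries) :
    AlternatesBelow n ((cothcSeries + tanhcSeries) * (X * d⁄dX ℝ legendreSeries)) :=
  (alternatesBelow_cothcSeries.add alternatesBelow_tanhcSeries).of_top.mul h.X_mul_derivative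

theorem alternatesBelow_legendreSeries : AlternatesBelow ⊤ legendreSeries :=
  .of_recurrence (c := fun i => i ^ 2) (fun _ hi => by positivity)
    (by simp [constantCoeff_legendreSeries])
    (fun _ h => (alternatesBelow_coth_add_tanh_mul h).add h)
    fun i _ => sq_mul_coeff_legendreSeries i

theorem coeff_legendreSeries_pos (k : ℕ) : 0 < (-1) ^ k * coeff (2 * k) legendreSeries := by
  induction k with
  | zero => simp [constantCoeff_legendreSeries]
  | succ k ih =>
    have h_nonneg := (alternatesBelow_coth_add_tanh_mul
      alternatesBelow_legendreSeries).coeff_even_nonneg k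
    have h_rec := sq_mul_coeff_legendreSeries (2 * k + 2)
    rw [coeff_X_pow_mul, map_add] at h_rec
    refine pos_of_mul_pos_right (a := ((2 * k + 2 : ℕ) : ℝ) ^ 2) ?_ (by positivity)
    calc 0 < _ := add_pos_of_nonneg_of_pos h_nonneg ih
      _ = _ := by
        rw [mul_add 2 k 1, mul_one]
        linear_combination (-1) ^ k * h_rec

/-- The Taylor series of `s * P_{-1/2}(cosh (2 * s)) * (1 / sinh s + 1 / cosh s)`. Its
coefficient of degree `k + 1`, multiplied by `-k! / 4 ^ (k + 1)`, is the coefficient of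
`1 / N ^ (k + 1)` in the expansion of `π * landauConstant`. -/
noncomputable def landauSeries : ℝ⟦X⟧ :=
  legendreSeries * (sinhcSeries⁻¹ + X * coshSeries⁻¹)

theorem coeff_succ_landauSeries_pos (l : ℕ) :
    0 < (-1 : ℝ) ^ (l * (l + 1) / 2) * coeff (l + 1) landauSeries := by
  have h_sinhc := alternatesBelow_legendreSeries.mul alternatesBelow_sinhcSeries_inv
  have h_cosh := alternatesBelow_legendreSeries.mul alternatesBelow_coshSeries_inv
  have h_coeff : coeff (l + 1) landauSeries = coeff (l + 1) (legendreSeries * sinhcSeries⁻¹) +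
      coeff l (legendreSeries * coshSeries⁻¹) := by
    rw [landauSeries, mul_add, mul_left_comm, map_add, coeff_succ_X_mul]
  rw [h_coeff]
  obtain ⟨k, rfl | rfl⟩ := l.even_or_odd'
  · have h_exp : 2 * k * (2 * k + 1) / 2 = 2 * (k * k) + k :=
      Nat.div_eq_of_eq_mul_right two_pos (by ring)
    rw [h_sinhc.coeff_odd, zero_add, h_exp, pow_add, pow_mul, neg_one_sq, one_pow, one_mul]
    exact alternatesBelow_legendreSeries.coeff_even_mul_pos alternatesBelow_coshSeries_inv
      (coeff_legendreSeries_pos k) (by simp [constantCoeff_coshSeries])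
  · have h_exp : (2 * k + 1) * (2 * k + 1 + 1) / 2 = 2 * (k * (k + 1)) + (k + 1) :=
      Nat.div_eq_of_eq_mul_right two_pos (by ring)
    rw [h_cosh.coeff_odd, add_zero, h_exp, pow_add, pow_mul, neg_one_sq, one_pow, one_mul]
    exact alternatesBelow_legendreSeries.coeff_even_mul_pos alternatesBelow_sinhcSeries_inv
      (coeff_legendreSeries_pos (k + 1)) (by simp [constantCoeff_sinhcSeries])

/-- The Taylor series of `exp (-s) * P_{-1/2}(cosh (2 * s))`, whose Laplace transform at `4 * N`
is a quarter of `π * wallisRatio N ^ 2`. -/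
noncomputable def summandSeries : ℝ⟦X⟧ :=
  (coshSeries - X * sinhcSeries) * legendreSeries

theorem constantCoeff_summandSeries : constantCoeff summandSeries = 1 := by
  simp [summandSeries, constantCoeff_coshSeries, constantCoeff_legendreSeries]

theorem rescale_exp_mul_derivative_derivative_summandSeries :
    rescale (-4) (exp ℝ) * d⁄dX ℝ (d⁄dX ℝ summandSeries) =
      d⁄dX ℝ (d⁄dX ℝ summandSeries) + 4 * d⁄dX ℝ summandSeries + 4 * summandSeries := by
  have h_exp : d⁄dX ℝ (coshSeries - X * sinhcSeries) = -(coshSeries - X * sinhcSeries) := by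
    rw [map_sub, derivative_coshSeries, derivative_X_mul_sinhcSeries, neg_sub]
  have h₁ : d⁄dX ℝ summandSeries =
      (coshSeries - X * sinhcSeries) * (d⁄dX ℝ legendreSeries - legendreSeries) := by
    rw [summandSeries, Derivation.leibniz, h_exp, smul_eq_mul, smul_eq_mul]
    ring
  have h₂ : d⁄dX ℝ (d⁄dX ℝ summandSeries) = (coshSeries - X * sinhcSeries) *
      (d⁄dX ℝ (d⁄dX ℝ legendreSeries) - 2 * d⁄dX ℝ legendreSeries + legendreSeries) := by
    rw [h₁, Derivation.leibniz, h_exp, map_sub, smul_eq_mul, smul_eq_mul]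
    ring
  rw [h₂, h₁, summandSeries, rescale_neg_four_exp]
  linear_combination
    -4 * (coshSeries - X * sinhcSeries) ^ 3 * legendreSeries_differential_equation +
    (coshSeries - X * sinhcSeries) * (coshSeries ^ 2 - (X * sinhcSeries) ^ 2 + 1) *
      (d⁄dX ℝ (d⁄dX ℝ legendreSeries) + 2 * d⁄dX ℝ legendreSeries + legendreSeries) *
      coshSeries_sq_sub

theorem one_sub_rescale_exp_mul_landauSeries :
    (1 - rescale (-4) (exp ℝ)) * landauSeries = 4 * (X * summandSeries) := by
  rw [landauSeries, summandSeries, rescale_neg_four_exp]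
  linear_combination
    4 * (coshSeries - X * sinhcSeries) ^ 2 * X * legendreSeries *
      (coshSeries * sinhcSeries_mul_inv + X * sinhcSeries * coshSeries_mul_inv) +
    (4 * X * (coshSeries - X * sinhcSeries) * legendreSeries -
      (coshSeries ^ 2 - (X * sinhcSeries) ^ 2 + 1) * legendreSeries *
        (sinhcSeries⁻¹ + X * coshSeries⁻¹)) * coshSeries_sq_sub

/-- The power series whose Laplace transform at `4 * N` is the non-constant part of the expansion of
`∑ k < N, π * wallisRatio k ^ 2 - log N`. -/
noncomputable def correctionSeries : ℝ⟦X⟧ :=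
  mk fun n => -coeff (n + 1) landauSeries

theorem X_mul_correctionSeries : X * correctionSeries = 1 - landauSeries := by
  ext n
  rcases n with _ | n
  · simp [landauSeries, constantCoeff_legendreSeries, constantCoeff_sinhcSeries]
  · simp [correctionSeries, coeff_one, coeff_succ_X_mul]

theorem X_mul_logStepSeries :
    X * (4 * summandSeries + (1 - rescale (-4) (exp ℝ)) * correctionSeries) =
      1 - rescale (-4) (exp ℝ) := by
  linear_combination (1 - rescale (-4) (exp ℝ)) * X_mul_correctionSeries -
    one_sub_rescale_exp_mul_landauSeries

end LegendreSeries

section LaplaceSum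

open PowerSeries Finset
open scoped Nat

/-- The formal Laplace transform `∑ k, k! * P_k / x ^ (k + 1)` of a power series `P`, truncated to
its first `L` terms. -/
noncomputable def laplaceSum (L : ℕ) (x : ℝ) : ℝ⟦X⟧ →ₗ[ℝ] ℝ :=
  ∑ k ∈ range L, (k ! / x ^ (k + 1) : ℝ) • coeff k

theorem laplaceSum_apply (L : ℕ) (x : ℝ) (P : ℝ⟦X⟧) :
    laplaceSum L x P = ∑ k ∈ range L, k ! / x ^ (k + 1) * coeff k P := by
  simp [laplaceSum]

theorem laplaceSum_zero (x : ℝ) (P : ℝ⟦X⟧) : laplaceSum 0 x P = 0 := by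
  rw [laplaceSum_apply, sum_range_zero]

theorem laplaceSum_succ (L : ℕ) (x : ℝ) (P : ℝ⟦X⟧) :
    laplaceSum (L + 1) x P = laplaceSum L x P + L ! / x ^ (L + 1) * coeff L P := by
  rw [laplaceSum_apply, laplaceSum_apply, sum_range_succ]

theorem mul_laplaceSum_succ (L : ℕ) {x : ℝ} (hx : x ≠ 0) (P : ℝ⟦X⟧) :
    x * laplaceSum (L + 1) x P = constantCoeff P + laplaceSum L x (d⁄dX ℝ P) := by
  rw [laplaceSum_apply, laplaceSum_apply, sum_range_succ', mul_add, mul_sum, add_comm]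
  congr 1
  · simp [hx]
  · refine sum_congr rfl fun k _ => ?_
    rw [coeff_derivative, Nat.factorial_succ]
    push_cast
    field_simp
    ring

theorem sq_mul_laplaceSum_add_two (L : ℕ) {x : ℝ} (hx : x ≠ 0) (P : ℝ⟦X⟧) :
    x ^ 2 * laplaceSum (L + 2) x P = x * constantCoeff P + constantCoeff (d⁄dX ℝ P) +
      laplaceSum L x (d⁄dX ℝ (d⁄dX ℝ P)) := by
  rw [sq, mul_assoc, mul_laplaceSum_succ (L + 1) hx, mul_add, mul_laplaceSum_succ L hx, add_assoc]

theorem laplaceSum_ofNat_mul (L : ℕ) (x : ℝ) (n : ℕ) [n.AtLeastTwo] (P : ℝ⟦X⟧) :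
    laplaceSum L x (ofNat(n) * P) = ofNat(n) * laplaceSum L x P := by
  simpa only [nsmul_eq_mul, Nat.cast_ofNat] using map_nsmul (laplaceSum L x) (OfNat.ofNat n) P

theorem isBigO_inv_pow_add (h : ℝ) (n : ℕ) :
    (fun x : ℝ => ((x + h) ^ n)⁻¹) =O[atTop] fun x => (x ^ n)⁻¹ := by
  have h_atTop : Tendsto (fun x : ℝ => x + h) atTop atTop :=
    tendsto_atTop_add_const_right _ h tendsto_id
  have h_const : (fun _ : ℝ => h) =O[atTop] fun x => x + h :=
    (isLittleO_const_left.2 (.inr (tendsto_norm_atTop_atTop.comp h_atTop))).isBigO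
  have h_id : (fun x : ℝ => x) =O[atTop] fun x => x + h :=
    ((isBigO_refl _ _).sub h_const).congr_left fun x => add_sub_cancel_right x h
  refine (h_id.pow n).inv_rev ?_
  filter_upwards [eventually_ne_atTop 0] with x hx h_zero
  exact absurd h_zero (pow_ne_zero n hx)

theorem isBigO_inv_pow_of_le {m n : ℕ} (hmn : m ≤ n) :
    (fun x : ℝ => (x ^ n)⁻¹) =O[atTop] fun x => (x ^ m)⁻¹ := by
  refine IsBigO.of_bound' ?_
  filter_upwards [eventually_ge_atTop 1] with x hx
  have : 0 < x := one_pos.trans_le hx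
  rw [Real.norm_of_nonneg (by positivity), Real.norm_of_nonneg (by positivity)]
  gcongr

theorem isBigO_inv_pow_succ_of_mul {f : ℝ → ℝ} {n : ℕ}
    (h : (fun x => x * f x) =O[atTop] fun x => (x ^ n)⁻¹) :
    f =O[atTop] fun x => (x ^ (n + 1))⁻¹ := by
  refine ((isBigO_refl (fun x : ℝ => x⁻¹) atTop).mul h).congr' ?_ ?_
  · filter_upwards [eventually_ne_atTop 0] with x hx
    exact inv_mul_cancel_left₀ hx _
  · exact Eventually.of_forall fun x => by simp only [pow_succ', mul_inv]

theorem laplaceSum_sub_laplaceSum_isBigO {L M : ℕ} (hLM : L ≤ M) (P : ℝ⟦X⟧) :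
    (fun x => laplaceSum M x P - laplaceSum L x P) =O[atTop] fun x => (x ^ (L + 1))⁻¹ := by
  induction M, hLM using Nat.le_induction with
  | base => simpa using isBigO_zero _ _
  | succ M hLM ih =>
    have h_last : (fun x : ℝ => M ! / x ^ (M + 1) * coeff M P) =O[atTop]
        fun x => (x ^ (L + 1))⁻¹ := by
      refine ((isBigO_inv_pow_of_le (by omega : L + 1 ≤ M + 1)).const_mul_left
        (M ! * coeff M P)).congr_left fun x => ?_
      ring
    refine (ih.add h_last).congr_left fun x => ?_
    rw [laplaceSum_succ]
    ring

theorem laplaceSum_isBigO (L : ℕ) (P : ℝ⟦X⟧) :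
    (fun x => laplaceSum L x P) =O[atTop] fun x => x⁻¹ := by
  simpa [laplaceSum_zero] using laplaceSum_sub_laplaceSum_isBigO L.zero_le P

theorem tendsto_laplaceSum (L : ℕ) (P : ℝ⟦X⟧) :
    Tendsto (fun x => laplaceSum L x P) atTop (nhds 0) :=
  (laplaceSum_isBigO L P).trans_tendsto tendsto_inv_atTop_zero

theorem tendsto_mul_laplaceSum (L : ℕ) (P : ℝ⟦X⟧) :
    Tendsto (fun x => x * laplaceSum (L + 1) x P) atTop (nhds (constantCoeff P)) := by
  have h := (tendsto_laplaceSum L (d⁄dX ℝ P)).const_add (constantCoeff P)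
  rw [add_zero] at h
  refine h.congr' ?_
  filter_upwards [eventually_ne_atTop 0] with x hx
  rw [mul_laplaceSum_succ L hx]

theorem derivative_rescale_exp_mul (h : ℝ) (P : ℝ⟦X⟧) :
    d⁄dX ℝ (rescale (-h) (exp ℝ) * P) =
      rescale (-h) (exp ℝ) * d⁄dX ℝ P - h • (rescale (-h) (exp ℝ) * P) := by
  have h_exp : d⁄dX ℝ (rescale (-h) (exp ℝ)) = -(C h * rescale (-h) (exp ℝ)) := by
    ext n
    rw [coeff_derivative, map_neg, coeff_C_mul, coeff_rescale, coeff_rescale, coeff_exp, coeff_exp,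
      Nat.factorial_succ]
    simp only [map_div₀, map_one, map_natCast]
    push_cast
    field_simp
    ring
  rw [Derivation.leibniz, h_exp, smul_eq_C_mul, smul_eq_mul, smul_eq_mul]
  ring

-- Translation of the argument of a Laplace transform multiplies its kernel by an exponential.
theorem laplaceSum_add_sub_isBigO (h : ℝ) (L : ℕ) (P : ℝ⟦X⟧) :
    (fun x => laplaceSum L (x + h) P - laplaceSum L x (rescale (-h) (exp ℝ) * P))
      =O[atTop] fun x => (x ^ (L + 1))⁻¹ := by
  induction L generalizing P with
  | zero => simpa [laplaceSum_zero] using isBigO_zero _ _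
  | succ L ih =>
    refine isBigO_inv_pow_succ_of_mul ?_
    have h_last : (fun x => laplaceSum (L + 1) (x + h) P - laplaceSum L (x + h) P) =O[atTop]
        fun x => (x ^ (L + 1))⁻¹ :=
      ((laplaceSum_sub_laplaceSum_isBigO L.le_succ P).comp_tendsto
        (tendsto_atTop_add_const_right _ h tendsto_id)).trans (isBigO_inv_pow_add h _)
    refine (((ih (d⁄dX ℝ P)).sub ((ih P).const_mul_left h)).sub
      (h_last.const_mul_left h)).congr' ?_ .rfl
    filter_upwards [eventually_ne_atTop 0, eventually_ne_atTop (-h)] with x hx hxh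
    have h_shift := mul_laplaceSum_succ L (x := x + h) (by simpa [add_eq_zero_iff_eq_neg]) P
    have h_exp := mul_laplaceSum_succ L hx (rescale (-h) (exp ℝ) * P)
    have h_const : constantCoeff (rescale (-h) (exp ℝ) * P) = constantCoeff P := by
      rw [map_mul, ← coeff_zero_eq_constantCoeff_apply (rescale _ _)]
      simp
    rw [derivative_rescale_exp_mul, h_const, map_sub, map_smul, smul_eq_mul] at h_exp
    linear_combination h_exp - h_shift

theorem factorial_mul_coeff_of_X_mul_eq {h : ℝ} {P : ℝ⟦X⟧}
    (hP : X * P = 1 - rescale (-h) (exp ℝ)) (k : ℕ) :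
    k ! * coeff k P = -((-h) ^ (k + 1) / (k + 1)) := by
  have hk := congrArg (coeff (k + 1)) hP
  rw [coeff_succ_X_mul, map_sub, coeff_one, if_neg k.succ_ne_zero, coeff_rescale, coeff_exp,
    Nat.factorial_succ] at hk
  rw [hk, map_div₀, map_one, map_natCast]
  push_cast
  field_simp
  ring

theorem log_add_sub_log_sub_laplaceSum_isBigO {h : ℝ} {P : ℝ⟦X⟧}
    (hP : X * P = 1 - rescale (-h) (exp ℝ)) (L : ℕ) :
    (fun x => Real.log (x + h) - Real.log x - laplaceSum L x P)
      =O[atTop] fun x => (x ^ (L + 1))⁻¹ := by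
  refine IsBigO.of_bound (2 * |h| ^ (L + 1)) ?_
  filter_upwards [eventually_gt_atTop (2 * |h|), eventually_gt_atTop 0] with x hx hx0
  have h_small : |-h / x| ≤ 1 / 2 := by
    rw [abs_div, abs_neg, abs_of_pos hx0, div_le_iff₀ hx0]
    linarith
  have h_taylor := Real.abs_log_sub_add_sum_range_le (h_small.trans_lt (by norm_num)) L
  have h_log : Real.log (1 - -h / x) = Real.log (x + h) - Real.log x := by
    rw [← Real.log_div (by linarith [neg_abs_le h, abs_nonneg h]) hx0.ne']
    congr 1
    field_simp
    ring
  have h_sum : ∑ k ∈ range L, (-h / x) ^ (k + 1) / ((k : ℝ) + 1) = -laplaceSum L x P := by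
    rw [laplaceSum_apply, ← sum_neg_distrib]
    refine sum_congr rfl fun k _ => ?_
    rw [div_mul_eq_mul_div, factorial_mul_coeff_of_X_mul_eq hP, div_pow]
    ring
  rw [h_log, h_sum, neg_add_eq_sub] at h_taylor
  calc ‖Real.log (x + h) - Real.log x - laplaceSum L x P‖
      ≤ |-h / x| ^ (L + 1) / (1 - |-h / x|) := h_taylor
    _ ≤ |-h / x| ^ (L + 1) / (1 / 2) := by gcongr; linarith
    _ = 2 * |h| ^ (L + 1) * ‖(x ^ (L + 1))⁻¹‖ := by
      rw [abs_div, abs_neg, div_pow, norm_inv, norm_pow, Real.norm_eq_abs]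
      ring

end LaplaceSum

section LandauExpansion

open Real PowerSeries Finset
open scoped Nat

theorem inv_pow_add_two_le_two_mul_sub {x : ℝ} (hx : 1 ≤ x) (p : ℕ) :
    (x ^ (p + 2))⁻¹ ≤ 2 * ((x ^ (p + 1))⁻¹ - ((x + 1) ^ (p + 1))⁻¹) := by
  have : 0 < x := one_pos.trans_le hx
  have h_pow : ((x + 1) ^ (p + 1))⁻¹ ≤ (x ^ p * (x + 1))⁻¹ := by
    rw [pow_succ]
    gcongr
    linarith
  calc (x ^ (p + 2))⁻¹ = (x ^ p)⁻¹ * (1 / (x * x)) := by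
        rw [pow_add, mul_inv, one_div, sq]
    _ ≤ (x ^ p)⁻¹ * (2 / (x * (x + 1))) := by
        gcongr ?_ * ?_
        rw [div_le_div_iff₀ (by positivity) (by positivity)]
        nlinarith
    _ = 2 * ((x ^ (p + 1))⁻¹ - (x ^ p * (x + 1))⁻¹) := by
        field_simp
        ring
    _ ≤ 2 * ((x ^ (p + 1))⁻¹ - ((x + 1) ^ (p + 1))⁻¹) := by gcongr

theorem isBigO_inv_pow_succ_of_sub_isBigO {E : Type*} [SeminormedAddCommGroup E] {u : ℕ → E} {p : ℕ}
    (hu : Tendsto u atTop (nhds 0))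
    (h_step : (fun N => u (N + 1) - u N) =O[atTop] fun N => ((N : ℝ) ^ (p + 2))⁻¹) :
    u =O[atTop] fun N => ((N : ℝ) ^ (p + 1))⁻¹ := by
  obtain ⟨c, hc, h_bound⟩ := h_step.exists_nonneg
  obtain ⟨M, hM⟩ := eventually_atTop.1 (h_bound.bound.and (eventually_ge_atTop 1))
  set w : ℕ → ℝ := fun k => ‖u (k + M)‖ - 2 * c * (((k + M : ℕ) : ℝ) ^ (p + 1))⁻¹ with hw
  have h_mono : Monotone w := monotone_nat_of_le_succ fun k => by
    obtain ⟨h_norm, h_one⟩ := hM (k + M) (Nat.le_add_left M k)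
    have h_inv := mul_le_mul_of_nonneg_left
      (inv_pow_add_two_le_two_mul_sub (Nat.one_le_cast.2 h_one) p) hc
    have h_tri := norm_sub_norm_le (u (k + M)) (u (k + M + 1))
    rw [norm_sub_rev] at h_tri
    rw [norm_of_nonneg (by positivity)] at h_norm
    simp only [hw, Nat.add_right_comm k 1 M]
    push_cast at h_inv h_norm ⊢
    linarith
  have h_lim : Tendsto w atTop (nhds 0) := by
    have h_pow : Tendsto (fun N : ℕ => ((N : ℝ) ^ (p + 1))⁻¹) atTop (nhds 0) :=
      ((tendsto_pow_atTop p.succ_ne_zero).comp tendsto_natCast_atTop_atTop).inv_tendsto_atTop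
    have h := (hu.norm.sub (h_pow.const_mul (2 * c))).comp (tendsto_add_atTop_nat M)
    rwa [norm_zero, mul_zero, sub_zero] at h
  refine IsBigO.of_bound (2 * c) (eventually_atTop.2 ⟨M, fun N hN => ?_⟩)
  obtain ⟨k, rfl⟩ := Nat.exists_eq_add_of_le' hN
  have h_le : w k ≤ 0 := h_mono.ge_of_tendsto h_lim k
  rw [norm_of_nonneg (r := (_ : ℝ)⁻¹) (by positivity)]
  linarith

theorem isBigO_comp_four_mul {f : ℝ → ℝ} {n : ℕ} (hf : f =O[atTop] fun x => (x ^ n)⁻¹) :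
    (fun N : ℕ => f (4 * N)) =O[atTop] fun N => ((N : ℝ) ^ n)⁻¹ := by
  refine (hf.comp_tendsto (tendsto_natCast_atTop_atTop.const_mul_atTop four_pos)).trans ?_
  refine ((isBigO_refl (fun N : ℕ => ((N : ℝ) ^ n)⁻¹) atTop).const_mul_left
    (4 ^ n : ℝ)⁻¹).congr_left fun N => ?_
  rw [Function.comp_apply, mul_pow, mul_inv]

theorem sq_mul_laplaceSum_summandSeries_sub_isBigO (L : ℕ) :
    (fun x => (x + 4) ^ 2 * laplaceSum (L + 2) (x + 4) summandSeries -
      (x + 2) ^ 2 * laplaceSum (L + 2) x summandSeries) =O[atTop] fun x => (x ^ (L + 1))⁻¹ := by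
  have h_shift := laplaceSum_add_sub_isBigO 4 L (d⁄dX ℝ (d⁄dX ℝ summandSeries))
  have h_one := laplaceSum_sub_laplaceSum_isBigO (Nat.le_add_right L 1) (d⁄dX ℝ summandSeries)
  have h_two := laplaceSum_sub_laplaceSum_isBigO (Nat.le_add_right L 2) summandSeries
  refine ((h_shift.sub (h_one.const_mul_left 4)).sub (h_two.const_mul_left 4)).congr' ?_ .rfl
  filter_upwards [eventually_gt_atTop 0] with x hx
  rw [rescale_exp_mul_derivative_derivative_summandSeries, map_add, map_add, laplaceSum_ofNat_mul,
    laplaceSum_ofNat_mul]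
  linear_combination sq_mul_laplaceSum_add_two L hx.ne' summandSeries +
    4 * mul_laplaceSum_succ (L + 1) hx.ne' summandSeries -
    sq_mul_laplaceSum_add_two L (by positivity : x + 4 ≠ 0) summandSeries

theorem laplaceSum_summandSeries_div_succ_sub (L N : ℕ) :
    4 * laplaceSum L (4 * (N + 1 : ℕ)) summandSeries / (π * wallisRatio (N + 1) ^ 2) -
        4 * laplaceSum L (4 * N) summandSeries / (π * wallisRatio N ^ 2) =
      4 * ((4 * (N : ℝ) + 4) ^ 2 * laplaceSum L (4 * N + 4) summandSeries -
        (4 * (N : ℝ) + 2) ^ 2 * laplaceSum L (4 * N) summandSeries) *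
        ((π * wallisRatio N ^ 2)⁻¹ * ((4 * (N : ℝ) + 2) ^ 2)⁻¹) := by
  have h_pos := wallisRatio_pos N
  rw [wallisRatio_succ, show (4 : ℝ) * (N + 1 : ℕ) = 4 * N + 4 by push_cast; ring]
  field_simp
  ring

theorem inv_wallisRatio_sq_mul_isBigO :
    (fun N : ℕ => (π * wallisRatio N ^ 2)⁻¹ * ((4 * (N : ℝ) + 2) ^ 2)⁻¹) =O[atTop]
      fun N => (N : ℝ)⁻¹ := by
  have h_inv : (fun N : ℕ => ((N : ℝ) * (π * wallisRatio N ^ 2))⁻¹) =O[atTop]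
      fun _ => (1 : ℝ) :=
    (tendsto_mul_pi_mul_wallisRatio_sq.inv₀ one_ne_zero).isBigO_one ℝ
  have h_frac : (fun N : ℕ => (N : ℝ) * ((4 * (N : ℝ) + 2) ^ 2)⁻¹) =O[atTop]
      fun N => (N : ℝ)⁻¹ := by
    refine IsBigO.of_bound' ?_
    filter_upwards [eventually_gt_atTop 0] with N hN
    have hN0 : (0 : ℝ) < N := Nat.cast_pos.2 hN
    rw [norm_of_nonneg (by positivity), norm_of_nonneg (by positivity), ← div_eq_mul_inv,
      inv_eq_one_div, div_le_div_iff₀ (by positivity) hN0]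
    nlinarith
  refine (h_inv.mul h_frac).congr' ?_ (.of_forall fun N => one_mul _)
  filter_upwards [eventually_gt_atTop 0] with N hN
  have hN0 : (N : ℝ) ≠ 0 := Nat.cast_ne_zero.2 hN.ne'
  rw [mul_inv, mul_mul_mul_comm, inv_mul_cancel₀ hN0, one_mul]

theorem tendsto_laplaceSum_summandSeries_div (L : ℕ) :
    Tendsto (fun N : ℕ => 4 * laplaceSum (L + 1) (4 * N) summandSeries / (π * wallisRatio N ^ 2))
      atTop (nhds 1) := by
  have h_num := (tendsto_mul_laplaceSum L summandSeries).comp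
    (tendsto_natCast_atTop_atTop.const_mul_atTop four_pos)
  rw [constantCoeff_summandSeries] at h_num
  have h := h_num.div tendsto_mul_pi_mul_wallisRatio_sq one_ne_zero
  rw [div_one] at h
  refine h.congr' ?_
  filter_upwards [eventually_gt_atTop 0] with N hN
  have hN0 : (N : ℝ) ≠ 0 := Nat.cast_ne_zero.2 hN.ne'
  rw [Pi.div_apply, Function.comp_apply, mul_right_comm, mul_comm _ (N : ℝ),
    mul_div_mul_left _ _ hN0]

-- Both sides solve the recurrence of `π * wallisRatio N ^ 2`, the Laplace sum only up to the
-- truncation error; the increments of their quotient therefore decay one order faster.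
theorem laplaceSum_summandSeries_sub_wallisRatio_isBigO (L : ℕ) :
    (fun N : ℕ => 4 * laplaceSum (L + 2) (4 * N) summandSeries - π * wallisRatio N ^ 2)
      =O[atTop] fun N => ((N : ℝ) ^ (L + 2))⁻¹ := by
  have h_residual := isBigO_comp_four_mul (sq_mul_laplaceSum_summandSeries_sub_isBigO L)
  have h_step := (h_residual.const_mul_left 4).mul inv_wallisRatio_sq_mul_isBigO
  have h_ratio := isBigO_inv_pow_succ_of_sub_isBigO (p := L)
    (sub_self (1 : ℝ) ▸ (tendsto_laplaceSum_summandSeries_div (L + 1)).sub_const 1)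
    (h_step.congr (fun N => by rw [sub_sub_sub_cancel_right, laplaceSum_summandSeries_div_succ_sub])
      fun N => by rw [← mul_inv, ← pow_succ])
  have h_wallis : (fun N : ℕ => π * wallisRatio N ^ 2) =O[atTop] fun N => (N : ℝ)⁻¹ := by
    refine ((isBigO_refl (fun N : ℕ => (N : ℝ)⁻¹) atTop).mul
      (tendsto_mul_pi_mul_wallisRatio_sq.isBigO_one ℝ)).congr' ?_ (.of_forall fun N => mul_one _)
    filter_upwards [eventually_gt_atTop 0] with N hN
    exact inv_mul_cancel_left₀ (Nat.cast_ne_zero.2 hN.ne') _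
  refine (h_ratio.mul h_wallis).congr (fun N => ?_) fun N => by rw [← mul_inv, ← pow_succ]
  rw [sub_mul, one_mul, div_mul_cancel₀ _ (by have := wallisRatio_pos N; positivity)]

theorem log_add_four_sub_log_sub_laplaceSum_isBigO (L : ℕ) :
    (fun x => Real.log (x + 4) - Real.log x - 4 * laplaceSum L x summandSeries +
        (laplaceSum L (x + 4) correctionSeries - laplaceSum L x correctionSeries))
      =O[atTop] fun x => (x ^ (L + 1))⁻¹ := by
  refine ((log_add_sub_log_sub_laplaceSum_isBigO X_mul_logStepSeries L).add
    (laplaceSum_add_sub_isBigO 4 L correctionSeries)).congr_left fun x => ?_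
  rw [map_add, laplaceSum_ofNat_mul, sub_mul, one_mul, map_sub]
  ring

theorem sum_wallisRatio_sq_sub_laplaceSum_isBigO (L : ℕ) :
    (fun N : ℕ => ∑ k ∈ range N, π * wallisRatio k ^ 2 - log N -
        (log 16 + eulerMascheroniConstant) - laplaceSum (L + 2) (4 * N) correctionSeries)
      =O[atTop] fun N => ((N : ℝ) ^ (L + 1))⁻¹ := by
  have h_lim := (tendsto_sum_pi_mul_wallisRatio_sq_sub_log.sub_const
    (log 16 + eulerMascheroniConstant)).sub ((tendsto_laplaceSum (L + 2) correctionSeries).comp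
      (tendsto_natCast_atTop_atTop.const_mul_atTop four_pos))
  rw [sub_self, sub_zero] at h_lim
  refine isBigO_inv_pow_succ_of_sub_isBigO h_lim ?_
  have h_log := isBigO_comp_four_mul ((log_add_four_sub_log_sub_laplaceSum_isBigO (L + 2)).trans
    (isBigO_inv_pow_of_le (Nat.le_succ (L + 2))))
  refine ((laplaceSum_summandSeries_sub_wallisRatio_isBigO L).add h_log).neg_left.congr' ?_ .rfl
  filter_upwards [eventually_gt_atTop 0] with N hN
  have hN0 : (N : ℝ) ≠ 0 := Nat.cast_ne_zero.2 hN.ne'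
  have h_cast : (4 : ℝ) * N + 4 = 4 * (N + 1 : ℕ) := by push_cast; ring
  rw [h_cast, log_mul four_ne_zero hN0, log_mul four_ne_zero (by positivity), sum_range_succ]
  ring

/-- The coefficients of the asymptotic expansion of `π * landauConstant` in powers of `1 / N`. Only
the indices `1 ≤ k` are meaningful. -/
noncomputable def granathCoeff (k : ℕ) : ℝ :=
  (k - 1)! * coeff (k - 1) correctionSeries / 4 ^ k

theorem granathTruncation_granathCoeff (l : ℕ) {N : ℝ} (hN : N ≠ 0) :
    granathTruncation granathCoeff l N = log N + (log 16 + eulerMascheroniConstant) +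
      laplaceSum l (4 * N) correctionSeries := by
  have h_sum : ∑ k ∈ Icc 1 l, granathCoeff k / N ^ k = laplaceSum l (4 * N) correctionSeries := by
    rw [laplaceSum_apply, ← Ico_add_one_right_eq_Icc, sum_Ico_eq_sum_range, Nat.add_sub_cancel]
    refine sum_congr rfl fun k _ => ?_
    rw [granathCoeff, Nat.add_sub_cancel_left, add_comm 1 k, mul_pow]
    field_simp
  rw [granathTruncation, h_sum, log_mul (by norm_num) hN]
  ring

theorem pi_mul_landauConstant (n : ℕ) :
    π * landauConstant n = ∑ k ∈ range (n + 1), π * wallisRatio k ^ 2 :=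
  mul_sum ..

theorem isGranathExpansion_granathCoeff : IsGranathExpansion granathCoeff := by
  intro l
  have h_drop := isBigO_comp_four_mul
    (laplaceSum_sub_laplaceSum_isBigO (Nat.le_add_right l 2) correctionSeries)
  have h_isLittleO : (fun N : ℕ => ((N : ℝ) ^ (l + 1))⁻¹) =o[atTop] fun N => 1 / (N : ℝ) ^ l := by
    refine (((isLittleO_one_iff ℝ).2 (tendsto_inv_atTop_nhds_zero_nat (𝕜 := ℝ))).mul_isBigO
      (isBigO_refl (fun N : ℕ => 1 / (N : ℝ) ^ l) atTop)).congr
      (fun N => ?_) fun N => one_mul _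
    rw [pow_succ', mul_inv, one_div]
  have h := (((sum_wallisRatio_sq_sub_laplaceSum_isBigO l).add h_drop).trans_isLittleO
    h_isLittleO).comp_tendsto (tendsto_add_atTop_nat 1)
  refine h.congr (fun n => ?_) fun n => ?_
  · rw [pi_mul_landauConstant, granathTruncation_granathCoeff l (by positivity),
      Function.comp_apply]
    push_cast
    ring
  · rw [Function.comp_apply, Nat.cast_add_one]

theorem granathTruncation_succ (α : ℕ → ℝ) (l : ℕ) (N : ℝ) :
    granathTruncation α (l + 1) N = granathTruncation α l N + α (l + 1) / N ^ (l + 1) := by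
  rw [granathTruncation, granathTruncation, sum_Icc_succ_top (Nat.le_add_left 1 l), add_assoc,
    add_assoc, add_assoc]

theorem granathTruncation_congr {α β : ℕ → ℝ} {l : ℕ} (h : ∀ k < l, α (k + 1) = β (k + 1))
    (N : ℝ) : granathTruncation α l N = granathTruncation β l N := by
  induction l with
  | zero => simp only [granathTruncation, Icc_eq_empty_of_lt zero_lt_one, sum_empty]
  | succ l ih =>
    rw [granathTruncation_succ, granathTruncation_succ, h l l.lt_succ_self,
      ih fun k hk => h k (hk.trans l.lt_succ_self)]

theorem IsGranathExpansion.coeff_unique {α β : ℕ → ℝ} (hα : IsGranathExpansion α)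
    (hβ : IsGranathExpansion β) (l : ℕ) : α (l + 1) = β (l + 1) := by
  induction l using Nat.strong_induction_on with
  | _ l ih =>
    have h_diff : (fun _ : ℕ => α (l + 1) - β (l + 1)) =o[atTop] fun _ => (1 : ℝ) := by
      refine (((hβ (l + 1)).sub (hα (l + 1))).mul_isBigO (isBigO_refl
        (fun n : ℕ => ((n : ℝ) + 1) ^ (l + 1)) atTop)).congr (fun n => ?_) fun n => ?_
      · have : (n : ℝ) + 1 ≠ 0 := by positivity
        rw [granathTruncation_succ, granathTruncation_succ, granathTruncation_congr ih]
        field_simp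
        ring
      · exact one_div_mul_cancel (by positivity)
    exact sub_eq_zero.1 (tendsto_nhds_unique tendsto_const_nhds ((isLittleO_one_iff ℝ).1 h_diff))

theorem granathCoeff_succ_mul_neg (l : ℕ) :
    (-1 : ℝ) ^ (l * (l + 1) / 2) * granathCoeff (l + 1) < 0 := by
  have h_pos : 0 < (l ! : ℝ) / 4 ^ (l + 1) *
      ((-1) ^ (l * (l + 1) / 2) * coeff (l + 1) landauSeries) :=
    mul_pos (by positivity) (coeff_succ_landauSeries_pos l)
  rw [granathCoeff, Nat.add_sub_cancel, correctionSeries, coeff_mk]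
  linear_combination h_pos

end LandauExpansion

theorem theorem1 :
    (∃ α : ℕ → ℝ, IsGranathExpansion α) ∧
      ∀ α : ℕ → ℝ, IsGranathExpansion α →
        ∀ l : ℕ, (-1 : ℝ) ^ (l * (l + 1) / 2) * α (l + 1) < 0 := by
  refine ⟨⟨granathCoeff, isGranathExpansion_granathCoeff⟩, fun α hα l => ?_⟩
  rw [hα.coeff_unique isGranathExpansion_granathCoeff l]
  exact granathCoeff_succ_mul_neg l
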